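/- Let $\mathcal{C}$ be a set of finitely generated groups. A group $H$ is residually-$\mathcal{C}$ if every $g\in H\setminus\{1\}$ has non-trivial image in some quotient of $H$ that belongs to $\mathcal{C}$ (up to isomorphism). $\mathcal{C}$ is equationally noetherian if for every $n$ and every set $Sys\subseteq\mathbb{F}_n$ of words in $n$ unknowns there is a finite $Sys_0\subseteq Sys$ such that, in every $G\in\mathcal{C}$, each tuple $(g_1,\dots,g_n)\in G^n$ that solves $Sys_0$ solves $Sys$. Marked groups (finitely generated groups with a finite generating tuple, up to isomorphism) are represented by names consisting of the number $k$ of generators followed by the characteristic function, along a fixed enumeration of the free group $\mathbb{F}_k$, of the set of relations. $\mathrm{Res}_{\mathcal{C}}$ is the map from marked groups to marked groups sending $(G,S)$ to its greatest residually-$\mathcal{C}$ quotient $G/\bigcap\{\ker f\mid f\colon G\twoheadrightarrow H,\ H\in\mathcal{C}\}$ with the induced marking. $\mathrm{Lim}_{\mathbb{N}}:\subseteq\mathbb{N}^{\mathbb{N}}\to\mathbb{N}$ maps a convergent sequence of natural numbers to its limit. $\le_W$ denotes continuous Weihrauch reducibility between multi-functions on represented spaces: $Q\le_W P$ if there are a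 represented space $V$ and multi-functions $h,k$ with continuous realizers such that $h\circ(\mathrm{id}_V\times P)\circ k$ is defined wherever $Q$ is and takes there only values of $Q$; and $Q<_W P$ means $Q\le_W P$ and $P\not\le_W Q$. (1) If $\mathcal{C}$ is equationally noetherian, then $\mathrm{Res}_{\mathcal{C}}<_W\mathrm{Lim}_{\mathbb{N}}$. (2) Suppose that every finitely generated subgroup of a group in $\mathcal{C}$ is residually-$\mathcal{C}$ (for instance, that $\mathcal{C}$ is closed under finitely generated subgroups) and that not every finitely generated group is residually-$\mathcal{C}$. Then $\mathcal{C}$ is equationally noetherian if and only if $\mathrm{Res}_{\mathcal{C}}<_W\mathrm{Lim}_{\mathbb{N}}$; and $\mathrm{Lim}_{\mathbb{N}}\le_W\mathrm{Res}_{\mathcal{C}}$ if and only if $\mathcal{C}$ is not equationally noetherian. -/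

import Mathlib

open Topology Filter

noncomputable section

namespace ResWeihrauch

/-! ### Represented spaces and multi-functions -/

/-- The underlying set of Baire space, which carries the product topology of discrete copies
of the natural numbers. -/
abbrev Baire : Type := ℕ → ℕ

/-- A represented space: a set `X` with a partial surjection `ρ` from Baire space onto it.
The partial function is given by its graph: `IsName p x` means `p ∈ dom ρ` and `ρ p = x`. -/
class RepresentedSpace (X : Type) where
  IsName : Baire → X → Prop
  eq_of_isName : ∀ {p : Baire} {x y : X}, IsName p x → IsName p y → x = y
  exists_isName : ∀ x : X, ∃ p : Baire, IsName p x

/-- Baire space is represented by the identity. -/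
instance : RepresentedSpace Baire where
  IsName p x := p = x
  eq_of_isName h h' := h.symm.trans h'
  exists_isName x := ⟨x, rfl⟩

/-- The discrete space of natural numbers: a name of `n` is a sequence with first term `n`. -/
instance : RepresentedSpace ℕ where
  IsName p n := p 0 = n
  eq_of_isName h h' := h.symm.trans h'
  exists_isName n := ⟨fun _ => n, rfl⟩

/-- The product representation: a name of `(x, y)` interleaves a name of `x` (even places)
with a name of `y` (odd places). -/
instance {X Y : Type} [RepresentedSpace X] [RepresentedSpace Y] : RepresentedSpace (X × Y) where
  IsName p z := RepresentedSpace.IsName (fun n => p (2 * n)) z.1 ∧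
    RepresentedSpace.IsName (fun n => p (2 * n + 1)) z.2
  eq_of_isName h h' := Prod.ext (RepresentedSpace.eq_of_isName h.1 h'.1)
    (RepresentedSpace.eq_of_isName h.2 h'.2)
  exists_isName z := by
    obtain ⟨p, hp⟩ := RepresentedSpace.exists_isName z.1
    obtain ⟨q, hq⟩ := RepresentedSpace.exists_isName z.2
    refine ⟨fun n => if n % 2 = 0 then p (n / 2) else q (n / 2), ?_, ?_⟩
    · convert hp using 2 with n
      simp
    · convert hq using 2 with n
      have h1 : (2 * n + 1) % 2 = 1 := by omega
      have h2 : (2 * n + 1) / 2 = n := by omega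
      simp [h1, h2]

/-- A (partial) multi-function from `X` to `Y`; its domain is the set of `x` with `f x`
nonempty. -/
abbrev MultiFun (X Y : Type) : Type := X → Set Y

namespace MultiFun

variable {X Y Z W : Type}

/-- The domain of a multi-function. -/
def dom (f : MultiFun X Y) : Set X := {x | (f x).Nonempty}

/-- A single-valued total function, seen as a multi-function. -/
def ofFun (f : X → Y) : MultiFun X Y := fun x => {f x}

/-- Composition `g ∘ f` of multi-functions: it is defined at `x` if `f` is defined at `x` and
`g` is defined at every value of `f` at `x`. -/
def comp (g : MultiFun Y Z) (f : MultiFun X Y) : MultiFun X Z :=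
  fun x => {z | f x ⊆ g.dom ∧ ∃ y ∈ f x, z ∈ g y}

/-- The product of two multi-functions. -/
def prod (f : MultiFun X Y) (g : MultiFun Z W) : MultiFun (X × Z) (Y × W) :=
  fun p => f p.1 ×ˢ g p.2

/-- `f` solves `g`: it is defined wherever `g` is, and each of its values there is a value
of `g`. -/
def Solves (f g : MultiFun X Y) : Prop :=
  g.dom ⊆ f.dom ∧ ∀ x ∈ g.dom, f x ⊆ g x

/-- A multi-function is continuously realizable if some partial function `F` on Baire space,
continuous on the set of all names of points of the domain of `f`, sends every name of such
a point `x` to a name of some element of `f x`. -/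
def ContinuouslyRealizable [RepresentedSpace X] [RepresentedSpace Y] (f : MultiFun X Y) : Prop :=
  ∃ F : Baire → Baire,
    ContinuousOn F {p | ∃ x ∈ f.dom, RepresentedSpace.IsName p x} ∧
    ∀ x ∈ f.dom, ∀ p, RepresentedSpace.IsName p x → ∃ y ∈ f x, RepresentedSpace.IsName (F p) y

end MultiFun

/-- Continuous Weihrauch reducibility `Q ≤_W P`. -/
def WeihrauchLE {X Y Z W : Type} [RepresentedSpace X] [RepresentedSpace Y] [RepresentedSpace Z]
    [RepresentedSpace W] (Q : MultiFun X Y) (P : MultiFun Z W) : Prop :=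
  ∃ (V : Type) (_ : RepresentedSpace V) (h : MultiFun (V × W) Y) (k : MultiFun X (V × Z)),
    h.ContinuouslyRealizable ∧ k.ContinuouslyRealizable ∧
    (h.comp (((MultiFun.ofFun (id : V → V)).prod P).comp k)).Solves Q

/-- Strict continuous Weihrauch reducibility `Q <_W P`. -/
def WeihrauchLT {X Y Z W : Type} [RepresentedSpace X] [RepresentedSpace Y] [RepresentedSpace Z]
    [RepresentedSpace W] (Q : MultiFun X Y) (P : MultiFun Z W) : Prop :=
  WeihrauchLE Q P ∧ ¬ WeihrauchLE P Q

/-- The problem `Lim_ℕ`: a converging sequence of natural numbers is sent to its limit. -/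
def LimNat : MultiFun Baire ℕ := fun u => {l | Tendsto u atTop (𝓝 l)}

/-! ### Marked groups -/

/-- A marked group up to isomorphism of marked groups: a number `rank` of generators and the
normal subgroup of relations in the free group on these generators. -/
structure MarkedGroup : Type where
  rank : ℕ
  relations : Subgroup (FreeGroup (Fin rank))
  normal : relations.Normal

attribute [instance] MarkedGroup.normal

/-- The underlying group of a marked group. -/
abbrev MarkedGroup.Carrier (M : MarkedGroup) : Type := FreeGroup (Fin M.rank) ⧸ M.relations

instance (k : ℕ) : Countable (FreeGroup (Fin k)) :=
  inferInstanceAs (Countable (Quot FreeGroup.Red.Step))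

/-- A fixed enumeration of the free group of rank `k`. -/
def enumFree (k : ℕ) : ℕ → FreeGroup (Fin k) :=
  (exists_surjective_nat (FreeGroup (Fin k))).choose

theorem enumFree_surjective (k : ℕ) : Function.Surjective (enumFree k) :=
  (exists_surjective_nat (FreeGroup (Fin k))).choose_spec

open Classical in
/-- The word problem representation of marked groups: a name consists of the number of
generators followed by the characteristic function of the set of relations. Its final topology
is that of the space of marked groups. -/
instance : RepresentedSpace MarkedGroup where
  IsName u M := u 0 = M.rank ∧
    ∀ i, u (i + 1) = if enumFree M.rank i ∈ M.relations then 1 else 0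
  eq_of_isName := by
    rintro u ⟨k, N, hN⟩ ⟨k', N', hN'⟩ ⟨h0, h⟩ ⟨h0', h'⟩
    obtain rfl : k = k' := h0.symm.trans h0'
    obtain rfl : N = N' := by
      ext w
      obtain ⟨i, rfl⟩ := enumFree_surjective k w
      have := (h i).symm.trans (h' i)
      by_cases h1 : enumFree k i ∈ N <;> by_cases h2 : enumFree k i ∈ N' <;> simp_all
    rfl
  exists_isName M :=
    ⟨fun n => Nat.casesOn n M.rank
      fun i => if enumFree M.rank i ∈ M.relations then 1 else 0, rfl, fun _ => rfl⟩

/-! ### Residual properties and equational noetherianity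

A set of groups is given as a family `C i`, `i : ι`; a group belongs to it if it is isomorphic
to some `C i`. -/

section Residual

universe u v w

variable {ι : Type u} (C : ι → Type v) [∀ i, Group (C i)]

/-- `H` is residually-`C`: every non-identity element has a non-identity image in a quotient
of `H` that belongs to `C`. -/
def IsResidually (H : Type w) [Group H] : Prop :=
  ∀ g : H, g ≠ 1 → ∃ (i : ι) (f : H →* C i), Function.Surjective f ∧ f g ≠ 1

/-- The intersection of the kernels of all homomorphisms from `H` onto groups of `C`. -/
def residualKernel (H : Type w) [Group H] : Subgroup H :=
  ⨅ (i : ι) (f : H →* C i) (_ : Function.Surjective f), f.ker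

instance residualKernel_normal (H : Type w) [Group H] : (residualKernel C H).Normal := by
  unfold residualKernel
  refine Subgroup.normal_iInf_normal fun i => Subgroup.normal_iInf_normal fun f =>
    Subgroup.normal_iInf_normal fun _ => inferInstance

/-- The greatest residually-`C` quotient of a marked group, with the induced marking. -/
def greatestResidualQuotient (M : MarkedGroup) : MarkedGroup where
  rank := M.rank
  relations := (residualKernel C M.Carrier).comap (QuotientGroup.mk' M.relations)
  normal := inferInstance

/-- The problem `Res_C` on the space of marked groups. -/
def Res : MultiFun MarkedGroup MarkedGroup := MultiFun.ofFun (greatestResidualQuotient C)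

/-- The algebraic set of all solutions, in the groups of `C`, of a system of equations. -/
def algebraicSet {n : ℕ} (Sys : Set (FreeGroup (Fin n))) : Set (Σ i : ι, Fin n → C i) :=
  {g | ∀ W ∈ Sys, FreeGroup.lift g.2 W = 1}

/-- `C` is equationally noetherian: every system of equations in finitely many unknowns is
equivalent over `C` to a finite subsystem. -/
def EquationallyNoetherian : Prop :=
  ∀ (n : ℕ) (Sys : Set (FreeGroup (Fin n))),
    ∃ Sys₀ ⊆ Sys, Sys₀.Finite ∧ algebraicSet C Sys = algebraicSet C Sys₀

end Residual

end ResWeihrauch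

end

/-!
Call the radical of a set of words the set of all words killed by every homomorphism onto a group
of `C` that kills the given ones; the greatest residual quotient of a marked group is the quotient
of the free group by the radical of its relations (`greatestResidualQuotient_eq`).

If `C` is equationally noetherian, then the radical of a set of words is the radical of a finite
subset. So the residual quotients can be coded by natural numbers, and the codes obtained from
longer and longer finite parts of a name stabilize, which reduces `Res C` to `Lim_ℕ`
(`EquationallyNoetherian.res_le_limNat`). Moreover radicals satisfy the ascending chain condition,
and marked groups close to a given one have at least its radical. In a reduction of `Lim_ℕ` to
`Res C`, take a converging sequence whose instance has maximal radical. Near it the radical is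
constant, so the reduction would solve `Lim_ℕ` continuously near a point, which is impossible
(`EquationallyNoetherian.not_limNat_le_res`).

If `C` is not equationally noetherian, there are words `W 0, W 1, …` in a free group `F` and
homomorphisms from `F` to groups of `C` that kill `W 0, …, W (m - 1)` but not `W m`
(`exists_infinite_chain`). The hypothesis on subgroups makes all these words visible to residual
quotients (`map_eq_one_of_mem_residualKernel`). To let `W i` die residually without a visible trace
in the marked group, start with a finitely generated group that is not residually-`C`. It embeds
into a finitely generated group `B` with an infinite family `y` of free generators that die in
all groups of `C` (`exists_free_family`). The relation `(W i, y c) = (1, y c)` between two copies of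
`F × B` has the residual consequence `W i = 1`. As it amalgamates free subgroups, normal forms
show that the amalgam over a set `T` of indices `c` depends continuously on `T`
(`exists_finset_amalgamProj_iff`). Given a sequence of natural numbers, impose at each change of
value, say at `t`, the relations that kill `W 0, …, W t`. If the sequence converges and `W m`
survives in the residual quotient, then there is no change from `m` on, so the term of index `m` is
the limit; and some `W m` survives as there are finitely many changes (`limNat_le_res`).
-/

open Topology Filter

namespace ResWeihrauch

/-! ### Realizers of a Weihrauch reduction -/

section Realizers

variable {X Y Z W : Type} [RepresentedSpace X] [RepresentedSpace Y] [RepresentedSpace Z]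
  [RepresentedSpace W]

/-- The interleaving of two sequences, so that a name of `x` interleaved with a name of `y` is a
name of `(x, y)`. -/
def interleave (p q : Baire) : Baire := fun n => if n % 2 = 0 then p (n / 2) else q (n / 2)

@[simp] theorem interleave_even (p q : Baire) (n : ℕ) : interleave p q (2 * n) = p n := by
  simp [interleave]

@[simp] theorem interleave_odd (p q : Baire) (n : ℕ) : interleave p q (2 * n + 1) = q n := by
  have h1 : (2 * n + 1) % 2 = 1 := by omega
  have h2 : (2 * n + 1) / 2 = n := by omega
  simp [interleave, h1, h2]

theorem isName_interleave {p q : Baire} {x : X} {y : Y} (hp : RepresentedSpace.IsName p x)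
    (hq : RepresentedSpace.IsName q y) : RepresentedSpace.IsName (interleave p q) (x, y) := by
  refine ⟨?_, ?_⟩
  · simpa using hp
  · simpa using hq

theorem continuous_interleave {T : Type*} [TopologicalSpace T] {f g : T → Baire}
    (hf : Continuous f) (hg : Continuous g) : Continuous fun t => interleave (f t) (g t) := by
  refine continuous_pi fun n => ?_
  by_cases h : n % 2 = 0
  · simpa [interleave, h, Function.comp_def] using (continuous_apply (n / 2)).comp hf
  · simpa [interleave, h, Function.comp_def] using (continuous_apply (n / 2)).comp hg

/-- A map from Baire space to `ℕ` is continuous if each value only depends on finitely many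
places of the argument. -/
theorem continuous_of_locally_finite_dependence {f : Baire → ℕ}
    (hf : ∀ u, ∃ n, ∀ u', (∀ i < n, u' i = u i) → f u' = f u) : Continuous f := by
  rw [continuous_def]
  intro s _
  rw [isOpen_iff_mem_nhds]
  intro u hu
  obtain ⟨n, hn⟩ := hf u
  have : ∀ᶠ u' in 𝓝 u, ∀ i ∈ Finset.range n, u' i = u i := by
    rw [Filter.eventually_all_finset]
    intro i _
    exact (continuous_apply i).continuousAt.eventually
      (show ∀ᶠ x in 𝓝 (u i), x = u i by simp [nhds_discrete])
  filter_upwards [this] with u' hu'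
  have := hn u' fun i hi => hu' i (Finset.mem_range.2 hi)
  simpa [Set.mem_preimage, this] using hu

/-- A reduction between multi-functions, unfolded to realizers: names are transformed by `K`
into names of instances of `P` (together with a parameter), and `H` turns solutions of these back
into solutions of `Q`. -/
theorem WeihrauchLE.exists_realizers {Q : MultiFun X Y} {P : MultiFun Z W}
    (hle : WeihrauchLE Q P) :
    ∃ (V : Type) (_ : RepresentedSpace V) (H K : Baire → Baire) (D : Set Baire),
      ContinuousOn K {p | ∃ x ∈ Q.dom, RepresentedSpace.IsName p x} ∧ ContinuousOn H D ∧
      ∀ x ∈ Q.dom, ∀ p, RepresentedSpace.IsName p x →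
        ∃ (v : V) (z : Z), RepresentedSpace.IsName (K p) (v, z) ∧
          ∀ w ∈ P z, ∀ q, RepresentedSpace.IsName q (v, w) →
            q ∈ D ∧ ∃ y ∈ Q x, RepresentedSpace.IsName (H q) y := by
  obtain ⟨V, iV, h, k, ⟨H, hHc, hH⟩, ⟨K, hKc, hK⟩, hdom, hval⟩ := hle
  have hk : ∀ x ∈ Q.dom, x ∈ k.dom := by
    intro x hx
    obtain ⟨_, _, _, hy, _⟩ := hdom hx
    obtain ⟨_, z, hz, _⟩ := hy
    exact ⟨z, hz⟩
  refine ⟨V, iV, H, K, _, hKc.mono ?_, hHc, ?_⟩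
  · rintro p ⟨x, hx, hp⟩
    exact ⟨x, hk x hx, hp⟩
  · intro x hx p hp
    obtain ⟨⟨v, z⟩, hvz, hname⟩ := hK x (hk x hx) p hp
    refine ⟨v, z, hname, fun w hw q hq => ?_⟩
    obtain ⟨_, hsub, y0, hy0, _⟩ := hdom hx
    have hmem : (v, w) ∈ (((MultiFun.ofFun (id : V → V)).prod P).comp k) x :=
      ⟨hy0.1, (v, z), hvz, by simp [MultiFun.ofFun], hw⟩
    have hd : (v, w) ∈ h.dom := hsub hmem
    refine ⟨⟨_, hd, hq⟩, ?_⟩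
    obtain ⟨y, hy, hy'⟩ := hH _ hd q hq
    exact ⟨y, hval x hx ⟨hsub, _, hmem, hy⟩, hy'⟩

end Realizers

theorem mem_relations_iff {u : Baire} {M : MarkedGroup} (h : RepresentedSpace.IsName u M) (i : ℕ) :
    enumFree M.rank i ∈ M.relations ↔ u (i + 1) = 1 := by
  rw [h.2 i]
  simp

/-! ### Radicals of systems of words -/

section Closure

universe u v

variable {ι : Type u} (C : ι → Type v) [∀ i, Group (C i)]

/-- The radical of a set `S` of words: all words that are killed by every homomorphism from the
free group onto a group of `C` that kills `S`. -/
def radical {k : ℕ} (S : Set (FreeGroup (Fin k))) : Subgroup (FreeGroup (Fin k)) :=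
  ⨅ (i : ι) (f : FreeGroup (Fin k) →* C i) (_ : Function.Surjective f ∧ ∀ w ∈ S, f w = 1), f.ker

theorem mem_radical {k : ℕ} {S : Set (FreeGroup (Fin k))} {w : FreeGroup (Fin k)} :
    w ∈ radical C S ↔ ∀ (i : ι) (f : FreeGroup (Fin k) →* C i), Function.Surjective f →
      (∀ w ∈ S, f w = 1) → f w = 1 := by
  simp [radical, Subgroup.mem_iInf, MonoidHom.mem_ker]

instance radical_normal {k : ℕ} (S : Set (FreeGroup (Fin k))) : (radical C S).Normal := by
  unfold radical
  exact Subgroup.normal_iInf_normal fun i => Subgroup.normal_iInf_normal fun f =>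
    Subgroup.normal_iInf_normal fun _ => inferInstance

theorem subset_radical {k : ℕ} (S : Set (FreeGroup (Fin k))) :
    S ⊆ (radical C S : Set (FreeGroup (Fin k))) :=
  fun w hw => (mem_radical C).2 fun _ _ _ h => h w hw

variable {C} in
theorem radical_le {k : ℕ} {S S' : Set (FreeGroup (Fin k))}
    (h : S ⊆ (radical C S' : Set (FreeGroup (Fin k)))) : radical C S ≤ radical C S' := by
  intro w hw
  rw [mem_radical] at hw ⊢
  intro i f hf hS'
  exact hw i f hf fun w' hw' => (mem_radical C).1 (h hw') i f hf hS'

theorem radical_mono {k : ℕ} {S S' : Set (FreeGroup (Fin k))} (h : S ⊆ S') :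
    radical C S ≤ radical C S' :=
  radical_le (h.trans (subset_radical C S'))

/-- The quotient of a free group by the radical of a set of words, as a marked group. -/
def radicalQuotient (k : ℕ) (S : Set (FreeGroup (Fin k))) : MarkedGroup :=
  ⟨k, radical C S, inferInstance⟩

theorem greatestResidualQuotient_eq (M : MarkedGroup) :
    greatestResidualQuotient C M = radicalQuotient C M.rank M.relations := by
  unfold greatestResidualQuotient radicalQuotient
  congr 1
  ext w
  rw [Subgroup.mem_comap, mem_radical]
  simp only [residualKernel, Subgroup.mem_iInf, MonoidHom.mem_ker]
  constructor
  · intro h i f hf hS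
    have := h i (QuotientGroup.lift M.relations f hS)
      (QuotientGroup.lift_surjective_of_surjective _ _ hf _)
    exact this
  · intro h i f hf
    refine h i (f.comp (QuotientGroup.mk' M.relations))
      (hf.comp (QuotientGroup.mk'_surjective _)) fun w hw => ?_
    have : QuotientGroup.mk' M.relations w = 1 := (QuotientGroup.eq_one_iff w).2 hw
    simp only [MonoidHom.comp_apply, this, map_one]

variable {C}

theorem EquationallyNoetherian.exists_finset (hC : EquationallyNoetherian C) {k : ℕ}
    (S : Set (FreeGroup (Fin k))) :
    ∃ S₀ : Finset (FreeGroup (Fin k)), (S₀ : Set _) ⊆ S ∧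
      radical C (S₀ : Set (FreeGroup (Fin k))) = radical C S := by
  obtain ⟨S₀, hsub, hfin, heq⟩ := hC k S
  refine ⟨hfin.toFinset, by simpa using hsub, le_antisymm (radical_mono C (by simpa using hsub)) ?_⟩
  intro w hw
  rw [mem_radical] at hw ⊢
  intro i f hf h0
  refine hw i f hf ?_
  have hlift : FreeGroup.lift (fun j => f (FreeGroup.of j)) = f := by ext; simp
  have hmem : (⟨i, fun j => f (FreeGroup.of j)⟩ : Σ i : ι, Fin k → C i) ∈ algebraicSet C S₀ := by
    intro W hW
    simp only [hlift]
    exact h0 W (by simpa using hW)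
  rw [← heq] at hmem
  intro W hW
  simpa only [hlift] using hmem W hW

/-- The ascending chain condition for radicals over an equationally noetherian family. -/
theorem EquationallyNoetherian.exists_maximal (hC : EquationallyNoetherian C) {k : ℕ}
    (𝓡 : Set (Subgroup (FreeGroup (Fin k)))) (hne : 𝓡.Nonempty)
    (h𝓡 : ∀ R ∈ 𝓡, ∃ S : Set (FreeGroup (Fin k)), R = radical C S) :
    ∃ R ∈ 𝓡, ∀ R' ∈ 𝓡, R ≤ R' → R' = R := by
  obtain ⟨R₀, hR₀⟩ := hne
  obtain ⟨R, -, hR⟩ := zorn_le_nonempty₀ 𝓡 (fun c hc hchain R₁ hR₁ => by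
    obtain ⟨S₀, hS₀, heq⟩ := hC.exists_finset (⋃ R ∈ c, (R : Set (FreeGroup (Fin k))))
    obtain ⟨R, hRc, hSR⟩ := DirectedOn.exists_mem_subset_of_finset_subset_biUnion
      (f := fun R : Subgroup (FreeGroup (Fin k)) => (R : Set (FreeGroup (Fin k))))
      ⟨R₁, hR₁⟩ hchain.directedOn hS₀
    refine ⟨R, hc hRc, fun R' hR' => ?_⟩
    obtain ⟨S, rfl⟩ := h𝓡 R (hc hRc)
    calc (R' : Subgroup (FreeGroup (Fin k)))
        ≤ radical C (⋃ R ∈ c, (R : Set (FreeGroup (Fin k)))) := fun w hw =>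
          subset_radical C _ (Set.mem_biUnion hR' hw)
      _ = radical C (S₀ : Set (FreeGroup (Fin k))) := heq.symm
      _ ≤ radical C S := radical_le hSR) R₀ hR₀
  exact ⟨R, hR.prop, fun R' hR' hle => le_antisymm (hR.le_of_ge hR' hle) hle⟩

end Closure

/-! ### Equationally noetherian families -/

section Noetherian

universe u v

variable {ι : Type u} {C : ι → Type v} [∀ i, Group (C i)]

open Classical in
/-- The finite set of those among the first `n` words of rank `u 0` that the sequence `u` marks as
relations. -/
noncomputable def markedRelations (u : Baire) (n : ℕ) : Finset (FreeGroup (Fin (u 0))) :=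
  ((Finset.range n).filter fun i => u (i + 1) = 1).image (enumFree (u 0))

theorem radicalQuotient_markedRelations_congr {u u' : Baire} {n : ℕ}
    (h : ∀ i < n + 1, u' i = u i) :
    radicalQuotient C (u' 0) (markedRelations u' n : Set (FreeGroup (Fin (u' 0)))) =
      radicalQuotient C (u 0) (markedRelations u n : Set (FreeGroup (Fin (u 0)))) := by
  have h0 : u' 0 = u 0 := h 0 (by omega)
  have hf : (Finset.range n).filter (fun i => u' (i + 1) = 1) =
      (Finset.range n).filter fun i => u (i + 1) = 1 := by
    refine Finset.filter_congr fun i hi => ?_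
    rw [h (i + 1) (by simpa using hi)]
  unfold markedRelations
  rw [hf, h0]

theorem exists_enumeration_radicalQuotient (C : ι → Type v) [∀ i, Group (C i)] :
    ∃ (d : ℕ → MarkedGroup) (c : MarkedGroup → ℕ),
      ∀ (k : ℕ) (S : Finset (FreeGroup (Fin k))),
        d (c (radicalQuotient C k (S : Set (FreeGroup (Fin k))))) =
          radicalQuotient C k (S : Set (FreeGroup (Fin k))) := by
  obtain ⟨d, hd⟩ : ∃ d : ℕ → MarkedGroup, ∀ (k : ℕ) (S : Finset (FreeGroup (Fin k))), ∃ j,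
      d j = radicalQuotient C k (S : Set (FreeGroup (Fin k))) := by
    obtain ⟨e, he⟩ := exists_surjective_nat (Σ k : ℕ, Finset (FreeGroup (Fin k)))
    refine ⟨fun j => radicalQuotient C (e j).1 ((e j).2 : Set (FreeGroup (Fin (e j).1))), ?_⟩
    intro k S
    obtain ⟨j, hj⟩ := he ⟨k, S⟩
    refine ⟨j, ?_⟩
    simp only
    rw [hj]
  exact ⟨d, Function.invFun d, fun k S => Function.invFun_eq (hd k S)⟩

/-- Over an equationally noetherian family, finitely many relations of a marked group already
determine its greatest residual quotient. -/
theorem EquationallyNoetherian.eventually_radicalQuotient (hC : EquationallyNoetherian C)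
    {u : Baire} {M : MarkedGroup} (hM : RepresentedSpace.IsName u M) :
    (∃ S : Finset (FreeGroup (Fin M.rank)),
      greatestResidualQuotient C M = radicalQuotient C M.rank (S : Set _)) ∧
    ∀ᶠ n in atTop, radicalQuotient C (u 0) (markedRelations u n : Set (FreeGroup (Fin (u 0)))) =
      greatestResidualQuotient C M := by
  obtain ⟨k, N, hN⟩ := M
  have h0 : u 0 = k := hM.1
  subst h0
  have hu : ∀ i, enumFree (u 0) i ∈ N ↔ u (i + 1) = 1 := mem_relations_iff hM
  obtain ⟨S₀, hS₀, heq⟩ := hC.exists_finset (N : Set (FreeGroup (Fin (u 0))))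
  have hquot : greatestResidualQuotient C ⟨u 0, N, hN⟩ = radicalQuotient C (u 0) (S₀ : Set _) := by
    rw [greatestResidualQuotient_eq]
    simp only [radicalQuotient, heq]
  refine ⟨⟨S₀, hquot⟩, ?_⟩
  rw [hquot]
  choose idx hidx using enumFree_surjective (u 0)
  filter_upwards [eventually_ge_atTop ((S₀.sup idx) + 1)] with n hn
  have h1 : (S₀ : Set (FreeGroup (Fin (u 0)))) ⊆ markedRelations u n := by
    intro w hw
    refine Finset.mem_coe.2 (Finset.mem_image.2 ⟨idx w, ?_, hidx w⟩)
    refine Finset.mem_filter.2 ⟨Finset.mem_range.2 ?_, ?_⟩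
    · have := Finset.le_sup (f := idx) hw
      omega
    · rw [← hu, hidx]
      exact hS₀ hw
  have h2 : (markedRelations u n : Set (FreeGroup (Fin (u 0)))) ⊆ N := by
    intro w hw
    obtain ⟨i, hi, rfl⟩ := Finset.mem_image.1 (Finset.mem_coe.1 hw)
    exact (hu i).2 (Finset.mem_filter.1 hi).2
  have h3 : radical C (markedRelations u n : Set (FreeGroup (Fin (u 0)))) =
      radical C (S₀ : Set (FreeGroup (Fin (u 0)))) :=
    le_antisymm ((radical_mono C h2).trans heq.ge) (radical_mono C h1)
  simp only [radicalQuotient, h3]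

/-- The quotients by radicals of finite sets can be coded by natural numbers, and the code of the
greatest residual quotient of a marked group is the limit of the codes computed from the finite
parts of a name. -/
theorem EquationallyNoetherian.res_le_limNat (hC : EquationallyNoetherian C) :
    WeihrauchLE (Res C) LimNat := by
  obtain ⟨d, c, hdc⟩ := exists_enumeration_radicalQuotient C
  choose name hname using fun M : MarkedGroup => RepresentedSpace.exists_isName M
  obtain ⟨a, ha_def⟩ : ∃ a : Baire → Baire, ∀ u n,
      a u n = c (radicalQuotient C (u 0) (markedRelations u n : Set _)) := ⟨_, fun _ _ => rfl⟩
  have ha : Continuous a := by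
    refine continuous_pi fun n => continuous_of_locally_finite_dependence fun u =>
      ⟨n + 1, fun u' hu' => ?_⟩
    rw [ha_def, ha_def, radicalQuotient_markedRelations_congr hu']
  have hlim : ∀ (u : Baire) (M : MarkedGroup), RepresentedSpace.IsName u M →
      ∃ l, Tendsto (a u) atTop (𝓝 l) ∧ d l = greatestResidualQuotient C M := by
    intro u M hu
    obtain ⟨⟨S, hS⟩, hev⟩ := hC.eventually_radicalQuotient hu
    refine ⟨c (greatestResidualQuotient C M), tendsto_const_nhds.congr' ?_, by rw [hS, hdc]⟩
    filter_upwards [hev] with n hn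
    rw [ha_def, hn]
  refine ⟨ℕ, inferInstance, fun z => {d z.2},
    fun M => {z | z.1 = 0 ∧ ∃ u, RepresentedSpace.IsName u M ∧ z.2 = a u}, ?_, ?_, ?_, ?_⟩
  · refine ⟨fun p => name (d (p 1)), ?_, ?_⟩
    · exact ((continuous_of_discreteTopology (f := fun j : ℕ => name (d j))).comp
        (continuous_apply 1)).continuousOn
    · rintro ⟨v, l⟩ - p ⟨-, hp⟩
      refine ⟨_, rfl, ?_⟩
      have : p 1 = l := hp
      rw [← this]
      exact hname _
  · refine ⟨fun p => interleave 0 (a p), (continuous_interleave continuous_const ha).continuousOn,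
      fun M _ p hp => ⟨(0, a p), ⟨rfl, p, hp, rfl⟩, ?_⟩⟩
    exact isName_interleave (x := 0) (y := a p) rfl rfl
  · rintro M -
    refine ⟨greatestResidualQuotient C M, fun z _ => ⟨_, rfl⟩, ?_⟩
    obtain ⟨u, hu⟩ := RepresentedSpace.exists_isName M
    obtain ⟨l, hl, hdl⟩ := hlim u M hu
    refine ⟨(0, l), ⟨?_, (0, a u), ⟨rfl, u, hu, rfl⟩, rfl, hl⟩, hdl.symm⟩
    rintro ⟨v, b⟩ ⟨rfl, u', hu', hb⟩
    obtain ⟨l', hl', -⟩ := hlim u' M hu'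
    have hb : b = a u' := hb
    exact ⟨(0, l'), rfl, by simpa [hb, LimNat] using hl'⟩
  · rintro M - X ⟨-, ⟨v, l⟩, ⟨-, ⟨v', b⟩, ⟨-, u, hu, hb⟩, -, hl⟩, hX⟩
    obtain ⟨l', hl', hd'⟩ := hlim u M hu
    have hb : b = a u := hb
    have hl : Tendsto b atTop (𝓝 l) := hl
    rw [hb] at hl
    have : l = l' := tendsto_nhds_unique hl hl'
    have hX : X = d l := hX
    rw [hX, this, hd']
    rfl

theorem tendsto_eventuallyConst (u : Baire) (n l : ℕ) :
    Tendsto (fun i => if i < n then u i else l) atTop (𝓝 l) := by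
  refine tendsto_const_nhds.congr' ?_
  filter_upwards [eventually_ge_atTop n] with i hi
  simp [not_lt.2 hi]

/-- Among marked groups named by the values of `K` on a set of sequences, one has a radical that is
maximal among those of the same rank. -/
theorem EquationallyNoetherian.exists_maximal_instance (hC : EquationallyNoetherian C) {V : Type}
    [RepresentedSpace V] {K : Baire → Baire} {s : Set Baire} (hs : s.Nonempty)
    (hK : ∀ u ∈ s, ∃ (v : V) (M : MarkedGroup), RepresentedSpace.IsName (K u) (v, M)) :
    ∃ u ∈ s, ∃ (v : V) (k : ℕ) (N : Subgroup (FreeGroup (Fin k))) (hN : N.Normal),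
      RepresentedSpace.IsName (K u) (v, (⟨k, N, hN⟩ : MarkedGroup)) ∧
      ∀ u' ∈ s, ∀ (v' : V) (N' : Subgroup (FreeGroup (Fin k))) (hN' : N'.Normal),
        RepresentedSpace.IsName (K u') (v', (⟨k, N', hN'⟩ : MarkedGroup)) →
        radical C (N : Set (FreeGroup (Fin k))) ≤ radical C (N' : Set (FreeGroup (Fin k))) →
        radical C (N' : Set (FreeGroup (Fin k))) = radical C (N : Set (FreeGroup (Fin k))) := by
  obtain ⟨u₀, hu₀⟩ := hs
  obtain ⟨v₀, ⟨k, N₀, hN₀⟩, hname₀⟩ := hK u₀ hu₀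
  let 𝓡 : Set (Subgroup (FreeGroup (Fin k))) :=
    {R | ∃ u ∈ s, ∃ (v : V) (N : Subgroup (FreeGroup (Fin k))) (hN : N.Normal),
      RepresentedSpace.IsName (K u) (v, (⟨k, N, hN⟩ : MarkedGroup)) ∧
        R = radical C (N : Set (FreeGroup (Fin k)))}
  obtain ⟨R, ⟨u, hu, v, N, hN, hname, hR⟩, hmax⟩ := hC.exists_maximal 𝓡
    ⟨_, u₀, hu₀, v₀, N₀, hN₀, hname₀, rfl⟩
    (fun R ⟨_, _, _, N, _, _, hR⟩ => ⟨(N : Set (FreeGroup (Fin k))), hR⟩)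
  subst hR
  exact ⟨u, hu, v, k, N, hN, hname, fun u' hu' v' N' hN' hname' hle =>
    hmax _ ⟨u', hu', v', N', hN', hname', rfl⟩ hle⟩

/-- A reduction of `Lim_ℕ` to `Res_C` would be locally constant, in its instances of `Res_C`, near
a converging sequence whose instance has maximal radical; but `Lim_ℕ` is nowhere continuous. -/
theorem EquationallyNoetherian.not_limNat_le_res (hC : EquationallyNoetherian C) :
    ¬ WeihrauchLE LimNat (Res C) := by
  intro hle
  obtain ⟨V, iV, H, K, D, hK, hH, hred⟩ := hle.exists_realizers
  have hset : {p : Baire | ∃ x ∈ LimNat.dom, RepresentedSpace.IsName p x} = LimNat.dom :=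
    Set.ext fun p => ⟨fun ⟨x, hx, hp⟩ => (show p = x from hp) ▸ hx, fun hp => ⟨p, hp, rfl⟩⟩
  rw [hset] at hK
  replace hred : ∀ u ∈ LimNat.dom, ∃ (v : V) (M : MarkedGroup),
      RepresentedSpace.IsName (K u) (v, M) ∧
        ∀ q, RepresentedSpace.IsName q (v, greatestResidualQuotient C M) →
          q ∈ D ∧ H q 0 ∈ LimNat u := by
    intro u hu
    obtain ⟨v, z, hvz, h⟩ := hred u hu u rfl
    refine ⟨v, z, hvz, fun q hq => ?_⟩
    obtain ⟨hqD, y, hy, hy'⟩ := h _ rfl q hq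
    exact ⟨hqD, (show H q 0 = y from hy') ▸ hy⟩
  have hsol : ∀ u ∈ LimNat.dom, ∀ (v : V) (M : MarkedGroup),
      RepresentedSpace.IsName (K u) (v, M) →
        ∀ q, RepresentedSpace.IsName q (v, radicalQuotient C M.rank M.relations) →
          q ∈ D ∧ H q 0 ∈ LimNat u := by
    intro u hu v M hname q hq
    obtain ⟨v', M', hname', h⟩ := hred u hu
    cases RepresentedSpace.eq_of_isName hname hname'
    exact h q (greatestResidualQuotient_eq C M ▸ hq)
  obtain ⟨u, hu, v, k, N, hN, hname, hmax⟩ := hC.exists_maximal_instance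
    (s := LimNat.dom) ⟨fun _ => 0, 0, tendsto_const_nhds⟩
    (fun u hu => (hred u hu).imp fun v h => h.imp fun M h => h.1)
  obtain ⟨S₀, hS₀, heq⟩ := hC.exists_finset (N : Set (FreeGroup (Fin k)))
  obtain ⟨q, hq⟩ := RepresentedSpace.exists_isName (radicalQuotient C k (N : Set (FreeGroup (Fin k))))
  let Φ : Baire → Baire := fun u' => interleave (fun n => K u' (2 * n)) q
  choose idx hidx using enumFree_surjective k
  have hcoord : ∀ j, ∀ᶠ u' in 𝓝[LimNat.dom] u, K u' j = K u j := fun j =>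
    ((continuous_apply j).continuousAt.comp_continuousWithinAt (hK u hu)).eventually
      (show ∀ᶠ x in 𝓝 (K u j), x = K u j by simp [nhds_discrete])
  -- Near `u` the relations in `S₀` persist, so by maximality the radical does not change.
  have hnear : ∀ᶠ u' in 𝓝[LimNat.dom] u, Φ u' ∈ D ∧ H (Φ u') 0 ∈ LimNat u' := by
    have hrel : ∀ᶠ u' in 𝓝[LimNat.dom] u,
        ∀ w ∈ S₀, K u' (2 * (idx w + 1) + 1) = K u (2 * (idx w + 1) + 1) := by
      rw [Filter.eventually_all_finset]
      exact fun w _ => hcoord _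
    filter_upwards [hcoord 1, hrel, self_mem_nhdsWithin] with u' h1 h2 hu'
    obtain ⟨v', ⟨k', N', hN'⟩, hname', -⟩ := hred u' hu'
    obtain rfl : k' = k := hname'.2.1.symm.trans (h1.trans hname.2.1)
    have hS₀' : (S₀ : Set (FreeGroup (Fin k'))) ⊆ N' := by
      intro w hw
      have h3 : enumFree k' (idx w) ∈ N' ↔ enumFree k' (idx w) ∈ N :=
        (mem_relations_iff hname'.2 (idx w)).trans
          ((Iff.of_eq (congrArg (· = 1) (h2 w hw))).trans (mem_relations_iff hname.2 (idx w)).symm)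
      rw [hidx] at h3
      exact h3.2 (hS₀ hw)
    have hR : radical C (N' : Set (FreeGroup (Fin k'))) = radical C N :=
      hmax u' hu' v' N' hN' hname' (heq.ge.trans (radical_mono C hS₀'))
    refine hsol u' hu' v' _ hname' _ (isName_interleave hname'.1 ?_)
    have : radicalQuotient C k' (N' : Set (FreeGroup (Fin k'))) = radicalQuotient C k' N := by
      simp only [radicalQuotient, hR]
    exact this ▸ hq
  have hu0 := hnear.self_of_nhdsWithin hu
  have hΦ : ContinuousWithinAt Φ LimNat.dom u := by
    refine tendsto_pi_nhds.2 fun n => ?_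
    by_cases h : n % 2 = 0
    · simpa [Φ, interleave, h] using
        (continuous_apply (2 * (n / 2))).continuousAt.tendsto.comp (hK u hu)
    · simp [Φ, interleave, h]
  have hHΦ : Tendsto (fun u' => H (Φ u') 0) (𝓝[LimNat.dom] u) (𝓝 (H (Φ u) 0)) :=
    (continuous_apply 0).continuousAt.tendsto.comp ((hH _ hu0.1).tendsto.comp
      (tendsto_nhdsWithin_iff.2 ⟨hΦ, hnear.mono fun _ h => h.1⟩))
  have hHconst := hHΦ.eventually
    (show ∀ᶠ x in 𝓝 (H (Φ u) 0), x = H (Φ u) 0 by simp [nhds_discrete])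
  -- Sequences with the limit `H (Φ u) 0 + 1` come arbitrarily close to `u`.
  let t : ℕ → Baire := fun n i => if i < n then u i else H (Φ u) 0 + 1
  have ht : Tendsto t atTop (𝓝[LimNat.dom] u) := by
    refine tendsto_nhdsWithin_iff.2 ⟨tendsto_pi_nhds.2 fun i => ?_,
      Eventually.of_forall fun n => ⟨_, tendsto_eventuallyConst u n _⟩⟩
    refine tendsto_const_nhds.congr' ?_
    filter_upwards [eventually_gt_atTop i] with n hn
    simp [t, hn]
  obtain ⟨n, hn1, hn2⟩ := (ht.eventually (hHconst.and hnear)).exists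
  have h1 : Tendsto (t n) atTop (𝓝 (H (Φ u) 0)) := hn1 ▸ hn2.2
  have := tendsto_nhds_unique h1 (tendsto_eventuallyConst u n _)
  omega

end Noetherian

/-! ### Amalgams over subsets of a free basis -/

section Amalgam

open Monoid

/-- The endomorphism of the free group that kills the basis elements outside `T`. -/
noncomputable def retraction {I : Type*} (T : Set I) : FreeGroup I →* FreeGroup I :=
  open Classical in FreeGroup.lift fun i => if i ∈ T then FreeGroup.of i else 1

theorem mem_closure_of_iff {I : Type*} {T : Set I} {v : FreeGroup I} :
    v ∈ Subgroup.closure (FreeGroup.of '' T) ↔ retraction T v = v := by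
  classical
  constructor
  · intro hv
    have : Set.EqOn (retraction T) (MonoidHom.id _) (FreeGroup.of '' T) := by
      rintro _ ⟨i, hi, rfl⟩
      simp [retraction, hi]
    exact MonoidHom.eqOn_closure this hv
  · intro h
    have hle : (retraction T).range ≤ Subgroup.closure (FreeGroup.of '' T) := by
      rw [retraction, FreeGroup.range_lift_eq_closure, Subgroup.closure_le]
      rintro _ ⟨i, rfl⟩
      by_cases hi : i ∈ T
      · simpa [hi] using Subgroup.subset_closure (Set.mem_image_of_mem _ hi)
      · simp [hi]
    exact hle ⟨v, h⟩

theorem exists_finite_support {I : Type*} (v : FreeGroup I) :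
    ∃ D : Finset I, v ∈ Subgroup.closure (FreeGroup.of '' (D : Set I)) := by
  classical
  induction v using FreeGroup.induction_on with
  | C1 => exact ⟨∅, one_mem _⟩
  | of i => exact ⟨{i}, Subgroup.subset_closure (by simp)⟩
  | inv_of i ih =>
    obtain ⟨D, hD⟩ := ih
    exact ⟨D, inv_mem hD⟩
  | mul x y hx hy =>
    obtain ⟨D, hD⟩ := hx
    obtain ⟨E, hE⟩ := hy
    refine ⟨D ∪ E, mul_mem (Subgroup.closure_mono ?_ hD) (Subgroup.closure_mono ?_ hE)⟩
    · exact Set.image_mono (by simp)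
    · exact Set.image_mono (by simp)

/-- Whether a word lies in the subgroup generated by a subset `T` of the basis only depends on the
trace of `T` on a finite set. -/
theorem exists_finset_mem_closure_iff {I : Type*} (v : FreeGroup I) :
    ∃ D : Finset I, ∀ T T' : Set I, (∀ i ∈ D, i ∈ T' ↔ i ∈ T) →
      (v ∈ Subgroup.closure (FreeGroup.of '' T') ↔
        v ∈ Subgroup.closure (FreeGroup.of '' T)) := by
  classical
  obtain ⟨D, hD⟩ := exists_finite_support v
  refine ⟨D, fun T T' h => ?_⟩
  rw [mem_closure_of_iff, mem_closure_of_iff]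
  have : Set.EqOn (retraction T') (retraction T) (FreeGroup.of '' (D : Set I)) := by
    rintro _ ⟨i, hi, rfl⟩
    simp [retraction, h i hi]
  rw [MonoidHom.eqOn_closure this hD]

variable {I : Type*} {A : Type*} [Group A]

/-- The inclusion into `A`, in the two ways given by the families `a false` and `a true`, of the
free group on the subset `T` of `I`. It is realized as a subgroup of the free group on `I`. -/
noncomputable def amalgamMap (a : Bool → I → A) (T : Set I) (b : Bool) :
    Subgroup.closure (FreeGroup.of '' T : Set (FreeGroup I)) →* A :=
  (FreeGroup.lift (a b)).comp (Subgroup.subtype _)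

/-- The quotient of the free product of two copies of `A` by the relations `a false i = a true i`
for `i ∈ T`, as an amalgam of two copies of `A`. -/
abbrev Amalgam (a : Bool → I → A) (T : Set I) : Type _ :=
  PushoutI (G := fun _ : Bool => A) (amalgamMap a T)

/-- The projection of the free product of two copies of `A` onto the amalgam. -/
noncomputable def amalgamProj (a : Bool → I → A) (T : Set I) :
    CoprodI (fun _ : Bool => A) →* Amalgam a T :=
  PushoutI.ofCoprodI

theorem amalgamProj_surjective (a : Bool → I → A) (T : Set I) :
    Function.Surjective (amalgamProj a T) := by
  intro x
  induction x using PushoutI.induction_on with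
  | of b g =>
    refine ⟨CoprodI.of (i := b) g, ?_⟩
    simp [amalgamProj]
  | base h =>
    rw [← PushoutI.of_apply_eq_base _ true]
    refine ⟨CoprodI.of (i := true) (amalgamMap a T true h), ?_⟩
    simp [amalgamProj]
  | mul x y hx hy =>
    obtain ⟨x, rfl⟩ := hx
    obtain ⟨y, rfl⟩ := hy
    exact ⟨x * y, map_mul _ _ _⟩

theorem amalgamProj_of_eq (a : Bool → I → A) {T : Set I} {i : I} (hi : i ∈ T) :
    amalgamProj a T (CoprodI.of (i := false) (a false i)) =
      amalgamProj a T (CoprodI.of (i := true) (a true i)) := by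
  have h : ∀ b, amalgamProj a T (CoprodI.of (i := b) (a b i)) = PushoutI.base (amalgamMap a T)
      ⟨FreeGroup.of i, Subgroup.subset_closure (Set.mem_image_of_mem _ hi)⟩ := by
    intro b
    rw [← PushoutI.of_apply_eq_base _ b]
    simp [amalgamProj, amalgamMap]
  rw [h, h]

/-- The universal property of the amalgam. -/
theorem exists_amalgam_lift {a : Bool → I → A} {T : Set I} {K : Type*} [Group K]
    (f : Bool → A →* K) (hf : ∀ i ∈ T, f false (a false i) = f true (a true i)) :
    ∃ F : Amalgam a T →* K, ∀ b x, F (amalgamProj a T (CoprodI.of (i := b) x)) = f b x := by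
  have key : ∀ b, (f b).comp (amalgamMap a T b) = (f true).comp (amalgamMap a T true) := by
    intro b
    ext ⟨v, hv⟩
    cases b
    · have : Set.EqOn ((f false).comp (FreeGroup.lift (a false)))
          ((f true).comp (FreeGroup.lift (a true))) (FreeGroup.of '' T) := by
        rintro _ ⟨i, hi, rfl⟩
        simpa using hf i hi
      exact MonoidHom.eqOn_closure this hv
    · rfl
  refine ⟨PushoutI.lift f _ key, fun b x => ?_⟩
  simp [amalgamProj]

/-- An element that dies in an amalgam dies because of finitely many relations. -/
theorem exists_finset_amalgamProj_eq_one {a : Bool → I → A} {T : Set I}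
    {g : CoprodI (fun _ : Bool => A)} (hg : amalgamProj a T g = 1) :
    ∃ D : Finset I, (D : Set I) ⊆ T ∧ ∀ T' : Set I, (D : Set I) ⊆ T' →
      amalgamProj a T' g = 1 := by
  classical
  let L : Subgroup (CoprodI (fun _ : Bool => A)) :=
    { carrier := {g | ∃ D : Finset I, (D : Set I) ⊆ T ∧ ∀ T' : Set I, (D : Set I) ⊆ T' →
        amalgamProj a T' g = 1}
      one_mem' := ⟨∅, by simp, fun _ _ => map_one _⟩
      mul_mem' := by
        rintro x y ⟨D, hD, hx⟩ ⟨E, hE, hy⟩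
        refine ⟨D ∪ E, by simp [hD, hE], fun T' hT' => ?_⟩
        simp only [Finset.coe_union, Set.union_subset_iff] at hT'
        rw [map_mul, hx T' hT'.1, hy T' hT'.2, one_mul]
      inv_mem' := by
        rintro x ⟨D, hD, hx⟩
        exact ⟨D, hD, fun T' hT' => by rw [map_inv, hx T' hT', inv_one]⟩ }
  have hL : L.Normal := ⟨by
    rintro x ⟨D, hD, hx⟩ y
    exact ⟨D, hD, fun T' hT' => by simp [hx T' hT']⟩⟩
  obtain ⟨F, hF⟩ := exists_amalgam_lift (a := a) (T := T)
    (fun b => (QuotientGroup.mk' L).comp (CoprodI.of (M := fun _ : Bool => A) (i := b)))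
    (by
      intro i hi
      refine (QuotientGroup.eq (s := L)).2 ⟨{i}, by simpa using hi, fun T' hT' => ?_⟩
      rw [map_mul, map_inv, amalgamProj_of_eq a (hT' (by simp)), inv_mul_cancel])
  have hFL : F.comp (amalgamProj a T) = QuotientGroup.mk' L :=
    CoprodI.ext_hom _ _ fun b => MonoidHom.ext fun x => hF b x
  have : QuotientGroup.mk' L g = 1 := by rw [← hFL, MonoidHom.comp_apply, hg, map_one]
  exact (QuotientGroup.eq_one_iff g).1 this

theorem exists_reduced {G : Bool → Type*} {H : Type*} [∀ i, Group (G i)] [Group H]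
    {φ : ∀ i, H →* G i} (hφ : ∀ i, Function.Injective (φ i)) (x : PushoutI φ) :
    ∃ (h : H) (w : CoprodI.Word G), PushoutI.Reduced φ w ∧
      x = PushoutI.base φ h * PushoutI.ofCoprodI w.prod := by
  classical
  obtain ⟨d⟩ := PushoutI.NormalWord.transversal_nonempty φ hφ
  let w := PushoutI.NormalWord.equiv (d := d) x
  refine ⟨w.head, w.toWord, ?_, ?_⟩
  · rintro ⟨i, g⟩ hg hr
    refine w.ne_one _ hg ?_
    have h1 := w.normalized i g hg
    have := (d.compl i).injective
      (a₁ := (⟨g, hr⟩, ⟨1, d.one_mem i⟩)) (a₂ := (⟨1, one_mem _⟩, ⟨g, h1⟩)) (by simp)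
    simpa using congrArg (fun z => (z.1 : G i)) this
  · exact (PushoutI.NormalWord.equiv.symm_apply_apply x).symm

theorem amalgamMap_injective {a : Bool → I → A}
    (ha : ∀ b, Function.Injective (FreeGroup.lift (a b))) (T : Set I) (b : Bool) :
    Function.Injective (amalgamMap a T b) :=
  (ha b).comp Subtype.val_injective

/-- An element that survives in an amalgam survives in all amalgams over index sets with the
same trace on a finite set, by the normal form theorem: its reduced form remains reduced. -/
theorem exists_finset_amalgamProj_ne_one {a : Bool → I → A}
    (ha : ∀ b, Function.Injective (FreeGroup.lift (a b))) {T : Set I}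
    {g : CoprodI (fun _ : Bool => A)} (hg : amalgamProj a T g ≠ 1) :
    ∃ D : Finset I, ∀ T' : Set I, (∀ i ∈ D, i ∈ T' ↔ i ∈ T) → amalgamProj a T' g ≠ 1 := by
  classical
  obtain ⟨⟨v, hv⟩, w, hw, hgw⟩ := exists_reduced (amalgamMap_injective ha T) (amalgamProj a T g)
  have hbase : ∀ (T' : Set I) (hv' : v ∈ Subgroup.closure (FreeGroup.of '' T')),
      PushoutI.base (amalgamMap a T') ⟨v, hv'⟩ =
        amalgamProj a T' (CoprodI.of (i := true) (FreeGroup.lift (a true) v)) := by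
    intro T' hv'
    rw [← PushoutI.of_apply_eq_base _ true]
    simp [amalgamProj, amalgamMap]
  rw [hbase] at hgw
  obtain ⟨D₁, hD₁T, hD₁⟩ := exists_finset_amalgamProj_eq_one (a := a) (T := T)
    (g := g⁻¹ * (CoprodI.of (M := fun _ : Bool => A) (i := true) (FreeGroup.lift (a true) v) *
      w.prod)) (by
      rw [map_mul, map_inv, hgw, map_mul]
      exact inv_mul_cancel _)
  obtain ⟨D₂, hD₂⟩ := exists_finset_mem_closure_iff v
  -- The letters of `w` stay outside the amalgamated subgroup.
  have hletter : ∀ x : Σ _ : Bool, A, ∃ D : Finset I, ∀ T' : Set I, (∀ i ∈ D, i ∈ T' ↔ i ∈ T) →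
      x.2 ∉ (amalgamMap a T x.1).range → x.2 ∉ (amalgamMap a T' x.1).range := by
    rintro ⟨b, x⟩
    by_cases hx : x ∈ (FreeGroup.lift (a b)).range
    · obtain ⟨y, rfl⟩ := hx
      obtain ⟨D, hD⟩ := exists_finset_mem_closure_iff y
      refine ⟨D, fun T' hT' hnot => ?_⟩
      rintro ⟨⟨z, hz⟩, hzy⟩
      obtain rfl : z = y := ha b hzy
      exact hnot ⟨⟨z, (hD T T' hT').1 hz⟩, rfl⟩
    · refine ⟨∅, fun T' _ _ => ?_⟩
      rintro ⟨⟨z, hz⟩, hzy⟩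
      exact hx ⟨z, hzy⟩
  choose E hE using hletter
  refine ⟨D₁ ∪ D₂ ∪ w.toList.toFinset.biUnion E, fun T' hT' hone => ?_⟩
  have h1 : (D₁ : Set I) ⊆ T' := fun i hi => (hT' i (by simp [Finset.mem_coe.1 hi])).2 (hD₁T hi)
  have hv' : v ∈ Subgroup.closure (FreeGroup.of '' T') :=
    (hD₂ T T' fun i hi => hT' i (by simp [hi])).2 hv
  have hred : PushoutI.Reduced (amalgamMap a T') w := by
    intro x hx
    refine hE x T' (fun i hi => hT' i ?_) (hw x hx)
    simp only [Finset.mem_union, Finset.mem_biUnion, List.mem_toFinset]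
    exact Or.inr ⟨x, hx, hi⟩
  have h2 := hD₁ T' h1
  rw [map_mul, map_inv, hone, inv_one, one_mul, map_mul, ← hbase T' hv'] at h2
  have hempty : w = .empty := hred.eq_empty_of_mem_range (amalgamMap_injective ha T')
    ⟨⟨v, hv'⟩⁻¹, by
      rw [map_inv]
      exact (eq_inv_of_mul_eq_one_right h2).symm⟩
  subst hempty
  simp only [CoprodI.Word.prod_empty, map_one, mul_one] at h2
  have hv1 : v = 1 := by
    have := PushoutI.base_injective (amalgamMap_injective ha T') (h2.trans (map_one _).symm)
    exact congrArg Subtype.val this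
  refine hg (hgw.trans ?_)
  simp [hv1]

/-- The set of relations of the amalgam depends continuously on the set of amalgamated elements. -/
theorem exists_finset_amalgamProj_iff {a : Bool → I → A}
    (ha : ∀ b, Function.Injective (FreeGroup.lift (a b))) (T : Set I)
    (g : CoprodI (fun _ : Bool => A)) :
    ∃ D : Finset I, ∀ T' : Set I, (∀ i ∈ D, i ∈ T' ↔ i ∈ T) →
      (amalgamProj a T' g = 1 ↔ amalgamProj a T g = 1) := by
  by_cases hg : amalgamProj a T g = 1
  · obtain ⟨D, hDT, hD⟩ := exists_finset_amalgamProj_eq_one hg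
    exact ⟨D, fun T' hT' => ⟨fun _ => hg, fun _ => hD T' fun i hi => (hT' i hi).2 (hDT hi)⟩⟩
  · obtain ⟨D, hD⟩ := exists_finset_amalgamProj_ne_one ha hg
    exact ⟨D, fun T' hT' => ⟨fun h => absurd h (hD T' hT'), fun h => absurd h hg⟩⟩

end Amalgam

/-! ### Free families in the normal closure of an element -/

section FreeFamily

/-- The translation action of a group on the free group over its underlying set. -/
def translation (Γ : Type*) [Group Γ] : Γ →* MulAut (FreeGroup Γ) where
  toFun γ := FreeGroup.freeGroupCongr (Equiv.mulLeft γ)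
  map_one' := by
    ext x
    induction x using FreeGroup.induction_on <;> simp_all
  map_mul' γ δ := by
    ext x
    induction x using FreeGroup.induction_on <;> simp_all [mul_assoc]

theorem translation_of {Γ : Type*} [Group Γ] (γ δ : Γ) :
    translation Γ γ (FreeGroup.of δ) = FreeGroup.of (γ * δ) := by
  simp [translation]

/-- The semidirect product of the free group over the underlying set of a group with that group,
acting by translation; it is the free product of the group with an infinite cyclic group. -/
abbrev TranslationProduct (Γ : Type*) [Group Γ] : Type _ := FreeGroup Γ ⋊[translation Γ] Γ

theorem TranslationProduct.inl_of_mul {Γ : Type*} [Group Γ] (γ δ : Γ) :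
    (SemidirectProduct.inl (FreeGroup.of (γ * δ)) : TranslationProduct Γ) =
      SemidirectProduct.inr γ * SemidirectProduct.inl (FreeGroup.of δ) *
        SemidirectProduct.inr γ⁻¹ := by
  rw [← translation_of, SemidirectProduct.inl_aut]

instance TranslationProduct.fg (Γ : Type*) [Group Γ] [Group.FG Γ] :
    Group.FG (TranslationProduct Γ) := by
  obtain ⟨S, hS, hfin⟩ := Group.fg_iff.1 ‹Group.FG Γ›
  refine Group.fg_iff.2 ⟨SemidirectProduct.inr '' S ∪ {SemidirectProduct.inl (FreeGroup.of 1)}, ?_,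
    (hfin.image _).union (Set.finite_singleton _)⟩
  set K : Subgroup (TranslationProduct Γ) := Subgroup.closure
    (SemidirectProduct.inr '' S ∪ {SemidirectProduct.inl (FreeGroup.of 1)})
  have hr : ∀ γ : Γ, (SemidirectProduct.inr γ : TranslationProduct Γ) ∈ K := by
    intro γ
    have : (⊤ : Subgroup Γ) ≤ K.comap SemidirectProduct.inr := by
      rw [← hS, Subgroup.closure_le]
      exact fun s hs => Subgroup.subset_closure (Or.inl ⟨s, hs, rfl⟩)
    exact this (Subgroup.mem_top γ)
  have hl : ∀ w : FreeGroup Γ, (SemidirectProduct.inl w : TranslationProduct Γ) ∈ K := by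
    intro w
    have : (⊤ : Subgroup (FreeGroup Γ)) ≤ K.comap SemidirectProduct.inl := by
      rw [← FreeGroup.closure_range_of, Subgroup.closure_le]
      rintro _ ⟨γ, rfl⟩
      change (SemidirectProduct.inl (FreeGroup.of γ) : TranslationProduct Γ) ∈ K
      rw [← mul_one γ, TranslationProduct.inl_of_mul]
      exact mul_mem (mul_mem (hr _) (Subgroup.subset_closure (Or.inr rfl))) (hr _)
    exact this (Subgroup.mem_top w)
  rw [eq_top_iff]
  intro x _
  rw [← SemidirectProduct.inl_left_mul_inr_right x]
  exact mul_mem (hl _) (hr _)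

/-- A nontrivial element `x` of a finitely generated group has, in some finitely generated
overgroup, a normal closure containing an infinite family of free generators: take the commutators
of `x` with free generators that are permuted freely by `H × ℤ`. -/
theorem exists_free_family {H : Type} [Group H] [Group.FG H] {x : H} (hx : x ≠ 1) :
    ∃ (B : Type) (_ : Group B) (_ : Group.FG B) (j : H →* B) (y : ℕ → B),
      Function.Injective (FreeGroup.lift y) ∧
      ∀ {K : Type*} [Group K] (f : B →* K), f (j x) = 1 → ∀ c, f (y c) = 1 := by
  classical
  let Γ := H × Multiplicative ℤ
  let γ : ℕ → Γ := fun c => (1, Multiplicative.ofAdd (c : ℤ))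
  let j : H →* TranslationProduct Γ := SemidirectProduct.inr.comp (MonoidHom.inl H _)
  let e : Γ → TranslationProduct Γ := fun δ => SemidirectProduct.inl (FreeGroup.of δ)
  have hxe : ∀ c, e ((x, 1) * γ c) * (e (γ c))⁻¹ = j x * e (γ c) * (j x)⁻¹ * (e (γ c))⁻¹ := by
    intro c
    simp only [e]
    rw [TranslationProduct.inl_of_mul]
    simp [j]
    rfl
  refine ⟨TranslationProduct Γ, inferInstance, inferInstance, j,
    fun c => e ((x, 1) * γ c) * (e (γ c))⁻¹, ?_, ?_⟩
  · let r : FreeGroup Γ →* FreeGroup ℤ :=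
      FreeGroup.lift fun δ => if δ.1 = x then FreeGroup.of δ.2.toAdd else 1
    have hfac : FreeGroup.lift (fun c => e ((x, 1) * γ c) * (e (γ c))⁻¹) =
        (SemidirectProduct.inl : FreeGroup Γ →* TranslationProduct Γ).comp
          (FreeGroup.lift fun c => FreeGroup.of ((x, 1) * γ c) * (FreeGroup.of (γ c))⁻¹) := by
      ext c <;> simp [e]
    have hr : r.comp (FreeGroup.lift fun c => FreeGroup.of ((x, 1) * γ c) *
        (FreeGroup.of (γ c))⁻¹) = FreeGroup.map (fun c : ℕ => (c : ℤ)) := by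
      ext c
      have hγ : ((x, 1) * γ c : Γ) = (x, Multiplicative.ofAdd (c : ℤ)) :=
        Prod.ext (mul_one x) (one_mul _)
      simp [r, hγ, γ, Ne.symm hx]
    rw [hfac]
    refine SemidirectProduct.inl_injective.comp ?_
    refine Function.Injective.of_comp (f := r) ?_
    rw [← MonoidHom.coe_comp, hr]
    exact FreeGroup.map_injective Nat.cast_injective
  · intro K _ f hf c
    beta_reduce
    rw [hxe]
    simp [hf]

end FreeFamily

/-! ### Residual kernels and homomorphisms -/

section Residual

universe u v w

variable {ι : Type u} {C : ι → Type v} [∀ i, Group (C i)]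

/-- If finitely generated subgroups of groups in `C` are residually-`C`, then surjectivity may be
dropped in the definition of the residual kernel. -/
theorem map_eq_one_of_mem_residualKernel
    (hC : ∀ (i : ι) (K : Subgroup (C i)), K.FG → IsResidually C K) {H : Type w} [Group H]
    [Group.FG H] {g : H} (hg : g ∈ residualKernel C H) {i : ι} (f : H →* C i) : f g = 1 := by
  by_contra hne
  obtain ⟨i', f', hf', hne'⟩ := hC i f.range ((Group.fg_iff_subgroup_fg _).1 inferInstance)
    (f.rangeRestrict g) (fun h => hne (congrArg Subtype.val h))
  simp only [residualKernel, Subgroup.mem_iInf, MonoidHom.mem_ker] at hg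
  exact hne' (hg i' (f'.comp f.rangeRestrict) (hf'.comp f.rangeRestrict_surjective))

/-- A family that is not equationally noetherian has solutions of longer and longer initial parts
of some sequence of equations which fail the next equation. -/
theorem exists_infinite_chain (hC : ¬ EquationallyNoetherian C) :
    ∃ (n : ℕ) (W : ℕ → FreeGroup (Fin n)), ∀ m, ∃ (i : ι) (f : FreeGroup (Fin n) →* C i),
      (∀ m' < m, f (W m') = 1) ∧ f (W m) ≠ 1 := by
  unfold EquationallyNoetherian at hC
  push Not at hC
  obtain ⟨n, Sys, hSys⟩ := hC
  obtain ⟨s, hs, hs'⟩ := exists_seq_of_forall_finset_exists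
    (fun a : FreeGroup (Fin n) × (Σ i : ι, Fin n → C i) =>
      a.1 ∈ Sys ∧ FreeGroup.lift a.2.2 a.1 ≠ 1)
    (fun a b => FreeGroup.lift b.2.2 a.1 = 1)
    (by
      classical
      intro S hS
      have hsub : ((S.image Prod.fst : Finset _) : Set (FreeGroup (Fin n))) ⊆ Sys := by
        intro w hw
        obtain ⟨a, ha, rfl⟩ := Finset.mem_image.1 (Finset.mem_coe.1 hw)
        exact (hS a ha).1
      have hne := hSys _ hsub (Finset.finite_toSet _)
      by_contra! hcon
      refine hne (Set.Subset.antisymm (fun g hg W hW => hg W (hsub hW)) fun g hg W hW => ?_)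
      by_contra hgW
      obtain ⟨a, ha, h⟩ := hcon (W, g) ⟨hW, hgW⟩
      exact h (hg _ (Finset.mem_coe.2 (Finset.mem_image_of_mem _ ha))))
  exact ⟨n, fun m => (s m).1, fun m => ⟨(s m).2.1, FreeGroup.lift (s m).2.2,
    fun m' hm' => hs' m' m hm', (hs m).2⟩⟩

end Residual

/-! ### A continuous family of marked groups with discontinuous residual quotients -/

section Family

open Monoid

universe u v

variable {ι : Type u} {C : ι → Type v} [∀ i, Group (C i)]

instance coprodI_fg {J : Type*} [Finite J] {G : J → Type*} [∀ j, Group (G j)]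
    [∀ j, Group.FG (G j)] : Group.FG (CoprodI G) := by
  have h : (⨆ j, (CoprodI.of (M := G) (i := j)).range) = ⊤ := by
    rw [← CoprodI.range_eq_iSup, MonoidHom.range_eq_top]
    refine fun x => ⟨x, ?_⟩
    have : CoprodI.lift (fun j => CoprodI.of (M := G) (i := j)) = MonoidHom.id _ :=
      CoprodI.ext_hom _ _ fun j => by ext; simp
    rw [this, MonoidHom.id_apply]
  rw [Group.fg_def, ← h]
  exact Subgroup.FG.iSup _ fun j => (Group.fg_iff_subgroup_fg _).1 inferInstance

theorem exists_surjective_freeGroup_fin (G : Type*) [Group G] [Group.FG G] :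
    ∃ (k : ℕ) (π : FreeGroup (Fin k) →* G), Function.Surjective π := by
  obtain ⟨α, _, φ, hφ⟩ := Group.fg_iff_exists_freeGroup_hom_surjective_finite.1 ‹Group.FG G›
  obtain ⟨k, ⟨e⟩⟩ := Finite.exists_equiv_fin α
  exact ⟨k, φ.comp (FreeGroup.freeGroupCongr e.symm).toMonoidHom,
    hφ.comp (FreeGroup.freeGroupCongr e.symm).surjective⟩

/-- A family of marked groups of the same rank, depending continuously on a set `T` of natural
numbers, whose residual quotients bound `T`: with `c` read as a pair of numbers, `c ∈ T` forces the
word indexed by the first one to die residually, and nothing else forces the death of a word of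
higher index.

The relation of index `c` identifies, in a free product of two copies of `F_n × B`, the elements
`(W_i, y_c)` and `(1, y_c)`, where `W` is an infinite chain of equations and the `y_c ∈ B` are
residually trivial. Thus it has the residual consequence `W_i = 1`, but as the `y_c` are free
generators it amalgamates free subgroups. -/
theorem exists_markedGroup_family
    (hC : ∀ (i : ι) (K : Subgroup (C i)), K.FG → IsResidually C K)
    (hM : ∃ M : MarkedGroup, ¬ IsResidually C M.Carrier) (hne : ¬ EquationallyNoetherian C) :
    ∃ (k : ℕ) (N : Set ℕ → Subgroup (FreeGroup (Fin k))) (hN : ∀ T, (N T).Normal)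
      (W : ℕ → FreeGroup (Fin k)),
      (∀ T w, ∃ D : Finset ℕ, ∀ T' : Set ℕ, (∀ c ∈ D, c ∈ T' ↔ c ∈ T) → (w ∈ N T' ↔ w ∈ N T)) ∧
      (∀ (T : Set ℕ), ∀ c ∈ T,
        W (Nat.unpair c).1 ∈ (greatestResidualQuotient C ⟨k, N T, hN T⟩).relations) ∧
      (∀ (T : Set ℕ) (m : ℕ), (∀ c ∈ T, (Nat.unpair c).1 < m) →
        W m ∉ (greatestResidualQuotient C ⟨k, N T, hN T⟩).relations) := by
  obtain ⟨n, w, hw⟩ := exists_infinite_chain hne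
  obtain ⟨M, hM⟩ := hM
  unfold IsResidually at hM
  push Not at hM
  obtain ⟨x, hx, hxC⟩ := hM
  have hx' : x ∈ residualKernel C M.Carrier := by
    simpa only [residualKernel, Subgroup.mem_iInf, MonoidHom.mem_ker] using hxC
  obtain ⟨B, iB, iBfg, j, y, hy, hyj⟩ := exists_free_family.{v} hx
  -- Every homomorphism from `B` to a group of `C` kills all `y c`.
  have hyC : ∀ {i : ι} (f : B →* C i) (c : ℕ), f (y c) = 1 := fun f c =>
    hyj f (map_eq_one_of_mem_residualKernel hC hx' (f.comp j)) c
  let a : Bool → ℕ → FreeGroup (Fin n) × B := fun b c =>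
    (if b then 1 else w (Nat.unpair c).1, y c)
  have ha : ∀ b, Function.Injective (FreeGroup.lift (a b)) := by
    intro b
    have h : (MonoidHom.snd (FreeGroup (Fin n)) B).comp (FreeGroup.lift (a b)) =
        FreeGroup.lift y := by
      ext c
      simp [a]
    refine Function.Injective.of_comp (f := MonoidHom.snd (FreeGroup (Fin n)) B) ?_
    rw [← MonoidHom.coe_comp, h]
    exact hy
  obtain ⟨k, π, hπ⟩ := exists_surjective_freeGroup_fin
    (CoprodI fun _ : Bool => FreeGroup (Fin n) × B)
  choose W hW using fun m => hπ (CoprodI.of (M := fun _ : Bool => FreeGroup (Fin n) × B)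
    (i := false) (w m, 1))
  refine ⟨k, fun T => ((amalgamProj a T).comp π).ker, fun T => inferInstance, W, ?_, ?_, ?_⟩
  · intro T v
    exact exists_finset_amalgamProj_iff ha T (π v)
  · intro T c hc
    change QuotientGroup.mk' _ (W (Nat.unpair c).1) ∈ residualKernel C _
    simp only [residualKernel, Subgroup.mem_iInf, MonoidHom.mem_ker]
    intro i f _
    let E := QuotientGroup.quotientKerEquivOfSurjective ((amalgamProj a T).comp π)
      ((amalgamProj_surjective a T).comp hπ)
    let g : Amalgam a T →* C i := f.comp E.symm.toMonoidHom
    have hg : ∀ v, f (QuotientGroup.mk' _ v) = g (amalgamProj a T (π v)) := by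
      intro v
      exact congrArg f (E.symm_apply_apply (QuotientGroup.mk' _ v)).symm
    let fb : Bool → FreeGroup (Fin n) × B →* C i := fun b =>
      (g.comp (amalgamProj a T)).comp
        (CoprodI.of (M := fun _ : Bool => FreeGroup (Fin n) × B) (i := b))
    have hfb : ∀ b, fb b (1, y c) = 1 := fun b => hyC ((fb b).comp (MonoidHom.inr _ _)) c
    have hrel : fb false (w (Nat.unpair c).1, y c) = fb true (1, y c) :=
      congrArg g (amalgamProj_of_eq a hc)
    have hsplit : ((w (Nat.unpair c).1, y c) : FreeGroup (Fin n) × B) =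
        (w (Nat.unpair c).1, 1) * (1, y c) := by simp
    rw [hsplit, map_mul, hfb, hfb, mul_one] at hrel
    rw [hg, hW]
    exact hrel
  · intro T m hT hmem
    obtain ⟨i, f, hf, hfm⟩ := hw m
    obtain ⟨F, hF⟩ := exists_amalgam_lift (a := a) (T := T)
      (fun b => if b then 1 else f.comp (MonoidHom.fst (FreeGroup (Fin n)) B))
      (fun c hc => by simpa [a] using hf _ (hT c hc))
    have hker : ∀ v ∈ ((amalgamProj a T).comp π).ker, (F.comp ((amalgamProj a T).comp π)) v = 1 :=
      fun v hv => by rw [MonoidHom.comp_apply, MonoidHom.mem_ker.1 hv, map_one]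
    have h := map_eq_one_of_mem_residualKernel hC (Subgroup.mem_comap.1 hmem)
      (QuotientGroup.lift _ _ hker)
    have h' : F (amalgamProj a T (π (W m))) = 1 := h
    rw [hW, hF] at h'
    exact hfm (by simpa using h')

/-- The codes of all pairs `(i, t)` with `i ≤ t` such that the sequence changes its value after
stage `t`. -/
def changes (u : Baire) : Set ℕ :=
  {c | (Nat.unpair c).1 ≤ (Nat.unpair c).2 ∧ u (Nat.unpair c).2 ≠ u ((Nat.unpair c).2 + 1)}

theorem eq_of_forall_changes {u : Baire} {m : ℕ} (h : ∀ c ∈ changes u, (Nat.unpair c).1 ≠ m) :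
    ∀ t, m ≤ t → u t = u m := by
  intro t ht
  induction t, ht using Nat.le_induction with
  | base => rfl
  | succ t ht ih =>
    rw [← ih]
    by_contra hne
    exact h (Nat.pair m t) (by simpa [changes] using ⟨ht, Ne.symm hne⟩) (by simp)

theorem exists_bound_changes {u : Baire} (hu : u ∈ LimNat.dom) :
    ∃ m, ∀ c ∈ changes u, (Nat.unpair c).1 < m := by
  obtain ⟨l, hl⟩ := hu
  have hl' : ∀ᶠ t in atTop, u t = l := by
    have h : Tendsto u atTop (𝓝 l) := hl
    rwa [nhds_discrete, tendsto_pure] at h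
  obtain ⟨m, hm⟩ := eventually_atTop.1 hl'
  refine ⟨m, fun c hc => ?_⟩
  by_contra! hle
  exact hc.2 ((hm _ (hle.trans hc.1)).trans (hm _ (hle.trans (hc.1.trans (Nat.le_succ _)))).symm)

/-- The changes of a sequence bring about relations that are seen in the residual quotient at
once; the first word that survives there bounds the last change. -/
theorem limNat_le_res
    (hC : ∀ (i : ι) (K : Subgroup (C i)), K.FG → IsResidually C K)
    (hM : ∃ M : MarkedGroup, ¬ IsResidually C M.Carrier) (hne : ¬ EquationallyNoetherian C) :
    WeihrauchLE LimNat (Res C) := by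
  classical
  obtain ⟨k, N, hN, W, hloc, hdie, hlive⟩ := exists_markedGroup_family hC hM hne
  choose idx hidx using enumFree_surjective k
  let G : Baire → MarkedGroup := fun u => ⟨k, N (changes u), hN _⟩
  let name : Baire → Baire := fun u n =>
    Nat.casesOn n k fun i => if enumFree k i ∈ N (changes u) then 1 else 0
  have hname : ∀ u, RepresentedSpace.IsName (name u) (G u) := by
    intro u
    refine ⟨rfl, fun i => ?_⟩
    change (if enumFree k i ∈ N (changes u) then 1 else 0) = _
    congr
  have hname_cont : Continuous name := by
    refine continuous_pi fun n => continuous_of_locally_finite_dependence fun u => ?_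
    rcases n with _ | i
    · exact ⟨0, fun _ _ => rfl⟩
    · obtain ⟨D, hD⟩ := hloc (changes u) (enumFree k i)
      refine ⟨D.sup (fun c => (Nat.unpair c).2) + 2, fun u' hu' => ?_⟩
      have : enumFree k i ∈ N (changes u') ↔ enumFree k i ∈ N (changes u) := by
        refine hD _ fun c hc => ?_
        have hle := Finset.le_sup (f := fun c => (Nat.unpair c).2) hc
        beta_reduce at hle
        simp only [changes, Set.mem_ofPred_eq]
        rw [hu' _ (by omega), hu' _ (by omega)]
      simp only [name, this]
  -- `S p m` holds if `p` names a pair whose second component does not satisfy the relation `W m`.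
  let S : Baire → ℕ → Prop := fun p m => p (2 * (idx (W m) + 1) + 1) ≠ 1
  have hS : ∀ (p u : Baire), RepresentedSpace.IsName p (u, greatestResidualQuotient C (G u)) →
      ∀ m, S p m ↔ W m ∉ (greatestResidualQuotient C (G u)).relations := by
    intro p u hp m
    have h := mem_relations_iff hp.2 (idx (W m))
    change enumFree k (idx (W m)) ∈ _ ↔ _ at h
    rw [hidx] at h
    exact (not_congr h).symm
  let h : MultiFun (Baire × MarkedGroup) ℕ := fun z => {l | ∀ p, RepresentedSpace.IsName p z →
    ∃ m, S p m ∧ (∀ m' < m, ¬ S p m') ∧ l = p (2 * m)}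
  have hval : ∀ u ∈ LimNat.dom, (h (u, greatestResidualQuotient C (G u))).Nonempty ∧
      h (u, greatestResidualQuotient C (G u)) ⊆ LimNat u := by
    intro u hu
    have hlim : ∀ m, W m ∉ (greatestResidualQuotient C (G u)).relations → u m ∈ LimNat u := by
      intro m hm
      refine tendsto_const_nhds.congr' ?_
      filter_upwards [eventually_ge_atTop m] with t ht
      exact (eq_of_forall_changes (fun c hc hcm => hm (by simpa only [hcm] using hdie _ c hc)) t ht).symm
    have hpu : ∀ p, RepresentedSpace.IsName p (u, greatestResidualQuotient C (G u)) →
        ∀ m, p (2 * m) = u m := fun p hp m => congrFun hp.1 m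
    refine ⟨?_, fun l hl => ?_⟩
    · obtain ⟨l, hl⟩ := hu
      refine ⟨l, fun p hp => ?_⟩
      obtain ⟨m, hm⟩ := exists_bound_changes ⟨l, hl⟩
      have hex : ∃ m, S p m := ⟨m, (hS p u hp m).2 (hlive _ m hm)⟩
      refine ⟨Nat.find hex, Nat.find_spec hex, fun m' hm' => Nat.find_min hex hm', ?_⟩
      rw [hpu p hp]
      exact tendsto_nhds_unique hl (hlim _ ((hS p u hp _).1 (Nat.find_spec hex)))
    · obtain ⟨p, hp⟩ := RepresentedSpace.exists_isName (u, greatestResidualQuotient C (G u))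
      obtain ⟨m, hm, -, rfl⟩ := hl p hp
      rw [hpu p hp]
      exact hlim m ((hS p u hp m).1 hm)
  refine ⟨Baire, inferInstance, h, MultiFun.ofFun fun u => (u, G u), ?_, ?_, ?_, ?_⟩
  · refine ⟨fun p _ => if hex : ∃ m, S p m then p (2 * Nat.find hex) else 0, ?_, ?_⟩
    · rintro p ⟨z, ⟨l, hl⟩, hp⟩
      obtain ⟨m, hm, hmin, -⟩ := hl p hp
      have hcoord : ∀ i : ℕ, ∀ᶠ p' in 𝓝 p, p' i = p i := fun i =>
        (continuous_apply i).continuousAt.eventually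
          (show ∀ᶠ x in 𝓝 (p i), x = p i by simp [nhds_discrete])
      have hnear : ∀ᶠ p' in 𝓝 p, ∀ m' ∈ Finset.range (m + 1), (S p' m' ↔ S p m') := by
        rw [Filter.eventually_all_finset]
        intro m' _
        filter_upwards [hcoord (2 * (idx (W m') + 1) + 1)] with p' hp'
        simp only [S, hp']
      have hfind : ∀ p', (∀ m' ∈ Finset.range (m + 1), (S p' m' ↔ S p m')) →
          ∀ hex : ∃ m, S p' m, Nat.find hex = m := by
        intro p' hp' hex
        refine (Nat.find_eq_iff hex).2 ⟨(hp' m (by simp)).2 hm, fun m' hm' => ?_⟩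
        rw [hp' m' (by simp; omega)]
        exact hmin m' hm'
      refine ContinuousAt.continuousWithinAt ?_
      refine tendsto_nhds_of_eventually_eq ?_
      filter_upwards [hnear, hcoord (2 * m)] with p' h1 h2
      have hex : ∃ m, S p m := ⟨m, hm⟩
      have hex' : ∃ m, S p' m := ⟨m, (h1 m (by simp)).2 hm⟩
      rw [dif_pos hex, dif_pos hex', hfind p' h1 hex', hfind p (fun _ _ => Iff.rfl) hex, h2]
    · rintro z ⟨l, hl⟩ p hp
      obtain ⟨m, hm, hmin, hlm⟩ := hl p hp
      refine ⟨l, hl, ?_⟩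
      have hex : ∃ m, S p m := ⟨m, hm⟩
      change (if hex : ∃ m, S p m then p (2 * Nat.find hex) else 0) = l
      rw [dif_pos hex, hlm, (Nat.find_eq_iff hex).2 ⟨hm, hmin⟩]
  · exact ⟨fun p => interleave p (name p),
      (continuous_interleave continuous_id hname_cont).continuousOn,
      fun u _ p hp => ⟨(u, G u), rfl, (show p = u from hp) ▸ isName_interleave rfl (hname p)⟩⟩
  · intro u hu
    obtain ⟨⟨l, hl⟩, -⟩ := hval u hu
    refine ⟨l, ?_, (u, greatestResidualQuotient C (G u)), ⟨?_, (u, G u), rfl, rfl, rfl⟩, hl⟩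
    · rintro ⟨u', R⟩ ⟨-, z, hz, hz1, hz2⟩
      obtain rfl : z = (u, G u) := hz
      obtain rfl : u' = u := hz1
      obtain rfl : R = greatestResidualQuotient C (G u') := hz2
      exact ⟨l, hl⟩
    · exact fun z _ => ⟨(z.1, greatestResidualQuotient C z.2), rfl, rfl⟩
  · rintro u hu l ⟨-, ⟨u', R⟩, ⟨-, z, hz, hz1, hz2⟩, hl⟩
    obtain rfl : z = (u, G u) := hz
    obtain rfl : u' = u := hz1
    obtain rfl : R = greatestResidualQuotient C (G u') := hz2
    exact (hval u' hu).2 hl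

end Family

end ResWeihrauch

open ResWeihrauch in
theorem theoremD {ι : Type*} (C : ι → Type*) [∀ i, Group (C i)] [∀ i, Group.FG (C i)] :
    (EquationallyNoetherian C → WeihrauchLT (Res C) LimNat) ∧
    ((∀ (i : ι) (K : Subgroup (C i)), K.FG → IsResidually C K) →
      (∃ M : MarkedGroup, ¬ IsResidually C M.Carrier) →
        (EquationallyNoetherian C ↔ WeihrauchLT (Res C) LimNat) ∧
        (WeihrauchLE LimNat (Res C) ↔ ¬ EquationallyNoetherian C)) := by
  have h1 : EquationallyNoetherian C → WeihrauchLT (Res C) LimNat := fun h =>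
    ⟨h.res_le_limNat, h.not_limNat_le_res⟩
  refine ⟨h1, fun hC hM => ⟨⟨h1, fun h => ?_⟩, fun h hne => (h1 hne).2 h, limNat_le_res hC hM⟩⟩
  by_contra hne
  exact h.2 (limNat_le_res hC hM hne)
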